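/- Let $d,n,l,N\ge 0$ be integers, and let states be points $z\in\mathbb R^d$ and velocities points of $\mathbb R^n$ (with the Euclidean norm $\lVert\cdot\rVert$). For $i=1,\dots,n$ let $m_i:\mathbb R^d\to\mathbb R$ be a prior mean, $k_i:\mathbb R^d\times\mathbb R^d\to\mathbb R$ a prior covariance function and $s_i\ge 0$ an observation noise variance ($s_i=0$ for exact observations). Given training data $Z=(z_1,\dots,z_N)$, $y_i\in\mathbb R^N$, with $K_i=(k_i(z_a,z_b))_{a,b}+s_iI$ invertible and $k_i(z,Z)=[k_i(z,z_1)\cdots k_i(z,z_N)]$, the posterior mean, covariance and variance are $$\bar v_{u,i}(z)=m_i(z)+k_i(z,Z)K_i^{-1}(y_i-m_i(Z)),\quad c_i(z,z')=k_i(z,z')-k_i(z,Z)K_i^{-1}k_i(z',Z)^{\mathsf T},\quad \sigma_{u,i}^2(z)=c_i(z,z).$$ Let $v_u=(v_{u,1},\dots,v_{u,n})$ be a sample of the posterior Gaussian process, i.e. a vector of independent Gaussian processes on $\mathbb R^d$, the $i$-th with mean function $\bar v_{u,i}$ and covariance function $c_i$. Let $S\subset\mathbb R^d$ be a compact set of states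 such that almost surely $z\mapsto v_u(z)$ is continuous on $S$, and $\sigma_{u,i}(z)>0$ for all $z\in S$ and all $i$. For $z\in S$ let $g(z,\cdot):\mathbb R^n\to\mathbb R^l$ be a constraint function (possibly independent of $z$), and let $$v(z,u)\in\operatorname*{argmin}_{\nu}\ \tfrac12\lVert\nu-u\rVert^2\quad\text{s.t.}\quad g(z,\nu)=0\qquad(u\in\mathbb R^n)$$ be the constrained least-squares projection. Assume that $v(z,\cdot)$ is, for every $z\in S$, a Lipschitz continuous function on $\mathbb R^n$ with Lipschitz constant $L$. Then for every $\delta\in(0,1)$ there is $\gamma>0$ such that, with probability at least $1-\delta$, the bound $$\lVert v(z,v_u(z))-v(z,\bar v_u(z))\rVert<\sqrt{\gamma}\,\sigma_{u,i}(z)$$ holds simultaneously for all states $z\in S$ and all $i=1,\dots,n$. (For $n=1$ this reads $|v(v_u)-v(\bar v_u)|<\sqrt\gamma\,\sigma_u(z)$.) -/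

import Mathlib

open MeasureTheory ProbabilityTheory
open scoped ENNReal NNReal Matrix

noncomputable section

namespace GPProjection

section Regression

variable {T : Type*} {N : ℕ}

/-- The row vector `k(z, Z) = [k(z, z₁), …, k(z, z_N)]`. -/
def kernelVec (k : T → T → ℝ) (Z : Fin N → T) (z : T) : Fin N → ℝ :=
  fun a => k z (Z a)

/-- The matrix `K(Z, Z) + s I`, where `K(Z, Z)` has the entries `k(z_a, z_b)` and `s` is the
variance of the observation noise; `s = 0` is regression on exact observations. -/
def gramMatrix (k : T → T → ℝ) (s : ℝ≥0) (Z : Fin N → T) : Matrix (Fin N) (Fin N) ℝ :=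
  Matrix.of (fun a b => k (Z a) (Z b)) + (s : ℝ) • (1 : Matrix (Fin N) (Fin N) ℝ)

/-- Posterior mean `m(z) + k(z, Z) (K(Z, Z) + s I)⁻¹ (y - m(Z))`. -/
def posteriorMean (m : T → ℝ) (k : T → T → ℝ) (s : ℝ≥0) (Z : Fin N → T) (y : Fin N → ℝ)
    (z : T) : ℝ :=
  m z + kernelVec k Z z ⬝ᵥ ((gramMatrix k s Z)⁻¹ *ᵥ (fun a => y a - m (Z a)))

/-- Posterior covariance `k(z, z') - k(z, Z) (K(Z, Z) + s I)⁻¹ k(z', Z)ᵀ`. -/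
def posteriorCov (k : T → T → ℝ) (s : ℝ≥0) (Z : Fin N → T) (z z' : T) : ℝ :=
  k z z' - kernelVec k Z z ⬝ᵥ ((gramMatrix k s Z)⁻¹ *ᵥ kernelVec k Z z')

/-- Posterior variance `σ²(z) = k(z, z) - k(z, Z) (K(Z, Z) + s I)⁻¹ k(z, Z)ᵀ`. -/
def posteriorVar (k : T → T → ℝ) (s : ℝ≥0) (Z : Fin N → T) (z : T) : ℝ :=
  posteriorCov k s Z z z

/-- Posterior standard deviation `σ(z)`. -/
def posteriorStd (k : T → T → ℝ) (s : ℝ≥0) (Z : Fin N → T) (z : T) : ℝ :=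
  Real.sqrt (posteriorVar k s Z z)

end Regression

section Sampling

variable {T Ω : Type*} [MeasurableSpace Ω]

/-- `f ∼ GP(m, c)`: a Gaussian process with mean function `m` and covariance function `c`. -/
structure IsGP (f : T → Ω → ℝ) (m : T → ℝ) (c : T → T → ℝ) (P : Measure Ω) : Prop where
  gaussian : IsGaussianProcess f P
  mean_eq : ∀ z, ∫ ω, f z ω ∂P = m z
  cov_eq : ∀ z z', covariance (f z) (f z') P = c z z'

/-- A vector-valued Gaussian process: a vector of independent real Gaussian processes. -/
structure IsVectorGP {n : ℕ} (f : T → Ω → EuclideanSpace ℝ (Fin n)) (m : Fin n → T → ℝ)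
    (c : Fin n → T → T → ℝ) (P : Measure Ω) : Prop where
  isGP : ∀ i, IsGP (fun z ω => f z ω i) (m i) (c i) P
  indep : iIndepFun (fun (i : Fin n) (ω : Ω) (z : T) => f z ω i) P

end Sampling

/-- `p` solves the constrained least-squares problem
`argmin_ν ½ ‖ν - u‖²` subject to `g(ν) = 0`. -/
def IsLeastSquaresProjection {V W : Type*} [NormedAddCommGroup V] [Zero W]
    (g : V → W) (u p : V) : Prop :=
  g p = 0 ∧ IsMinOn (fun ν => (1 / 2 : ℝ) * ‖ν - u‖ ^ 2) {ν | g ν = 0} p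

end GPProjection

end

namespace GPProjection

open Filter Topology

section PathBounds

variable {T Ω E : Type*} [MeasurableSpace Ω] [TopologicalSpace T]

/-- A process with almost surely continuous paths on a compact set is bounded on that set,
uniformly on events of probability arbitrarily close to one. -/
theorem exists_measurableSet_forall_norm_le [TopologicalSpace.PseudoMetrizableSpace T]
    [NormedAddCommGroup E] [MeasurableSpace E] [OpensMeasurableSpace E]
    {P : Measure Ω} [IsProbabilityMeasure P] {S : Set T} (hS : IsCompact S) {X : T → Ω → E}
    (hX : ∀ z ∈ S, AEMeasurable (X z) P) (hcont : ∀ᵐ ω ∂P, ContinuousOn (fun z => X z ω) S)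
    {p : ℝ≥0∞} (hp : p < 1) :
    ∃ M : ℝ, 0 ≤ M ∧ ∃ A : Set Ω, MeasurableSet A ∧ p ≤ P A ∧
      ∀ ω ∈ A, ∀ z ∈ S, ‖X z ω‖ ≤ M := by
  obtain ⟨t, htS, htc, hSt⟩ := hS.isSeparable.exists_countable_dense_subset
  have hF : AEMeasurable (fun ω => ⨆ z ∈ t, ‖X z ω‖ₑ) P :=
    AEMeasurable.biSup t htc fun z hz => (hX z (htS hz)).enorm
  have hG := hcont.and hF.ae_eq_mk
  set G : Set Ω :=
    (toMeasurable P {ω | ¬(ContinuousOn (fun z => X z ω) S ∧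
      (⨆ z ∈ t, ‖X z ω‖ₑ) = hF.mk _ ω)})ᶜ
  have hGm : MeasurableSet G := (measurableSet_toMeasurable _ _).compl
  have hG1 : P G = 1 := by
    rw [prob_compl_eq_one_iff (measurableSet_toMeasurable _ _), measure_toMeasurable]
    exact hG
  have hGs : ∀ ω ∈ G, ContinuousOn (fun z => X z ω) S ∧ (⨆ z ∈ t, ‖X z ω‖ₑ) = hF.mk _ ω := by
    intro ω hω
    by_contra h
    exact hω (subset_toMeasurable _ _ h)
  have hmono : Monotone fun j : ℕ => {ω | hF.mk _ ω ≤ (j : ℝ≥0∞)} ∩ G := fun a b hab ω hω =>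
    ⟨(show hF.mk _ ω ≤ (b : ℝ≥0∞) from le_trans hω.1 (Nat.cast_le.2 hab)), hω.2⟩
  have hU : ⋃ j : ℕ, {ω | hF.mk _ ω ≤ (j : ℝ≥0∞)} ∩ G = G := by
    refine subset_antisymm (Set.iUnion_subset fun j => Set.inter_subset_right) fun ω hω => ?_
    obtain ⟨C, hC⟩ := hS.exists_bound_of_continuousOn (hGs ω hω).1
    obtain ⟨j, hj⟩ := exists_nat_ge C
    refine Set.mem_iUnion.2 ⟨j, ?_, hω⟩
    rw [Set.mem_ofPred_eq, ← (hGs ω hω).2]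
    refine iSup₂_le fun z hz => ?_
    rw [← ofReal_norm, ← ENNReal.ofReal_natCast]
    exact ENNReal.ofReal_le_ofReal ((hC z (htS hz)).trans hj)
  have hlim := tendsto_measure_iUnion_atTop (μ := P) hmono
  rw [hU, hG1] at hlim
  obtain ⟨j, hj⟩ := (hlim.eventually (lt_mem_nhds hp)).exists
  refine ⟨j, j.cast_nonneg, _,
    (measurableSet_le hF.measurable_mk measurable_const).inter hGm, hj.le, ?_⟩
  rintro ω ⟨hωj, hωG⟩ z hz
  obtain ⟨hc, he⟩ := hGs ω hωG
  have ht : ∀ x ∈ t, ‖X x ω‖ ≤ j := by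
    intro x hx
    have h1 : ‖X x ω‖ₑ ≤ (j : ℝ≥0∞) :=
      (le_iSup₂ (f := fun z (_ : z ∈ t) => ‖X z ω‖ₑ) x hx).trans (he.trans_le hωj)
    rw [← ofReal_norm, ← ENNReal.ofReal_natCast] at h1
    exact (ENNReal.ofReal_le_ofReal_iff j.cast_nonneg).1 h1
  have : (𝓝[t] z).NeBot := mem_closure_iff_nhdsWithin_neBot.1 (hSt hz)
  exact le_of_tendsto ((hc z hz).mono htS).norm (eventually_nhdsWithin_of_forall ht)

end PathBounds

section GaussianMoments

variable {T Ω : Type*} [MeasurableSpace Ω] {P : Measure Ω}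

theorem norm_integral_cexp_eq_of_hasGaussianLaw {X : Ω → ℝ} (hX : HasGaussianLaw X P) :
    ‖∫ ω, Complex.exp (X ω * Complex.I) ∂P‖ = Real.exp (-(variance X P / 2)) := by
  have h := hX.charFun_map_eq (1 : ℝ)
  rw [charFun_apply_real, integral_map hX.aemeasurable (by fun_prop)] at h
  simp only [Complex.ofReal_one, one_mul] at h
  rw [h, Complex.norm_exp]
  simp

variable [TopologicalSpace T]

/-- The variance of a process with Gaussian marginals and almost surely continuous paths is
continuous. -/
theorem continuousOn_variance_of_hasGaussianLaw [FirstCountableTopology T] [IsFiniteMeasure P]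
    {S : Set T} {X : T → Ω → ℝ}
    (hX : ∀ z ∈ S, HasGaussianLaw (X z) P)
    (hcont : ∀ᵐ ω ∂P, ContinuousOn (fun z => X z ω) S) :
    ContinuousOn (fun z => variance (X z) P) S := by
  have h1 : ContinuousOn (fun z => ∫ ω, Complex.exp (X z ω * Complex.I) ∂P) S := by
    refine continuousOn_of_dominated (bound := fun _ => 1) (fun z hz => ?_) (fun z _ => ?_)
      (integrable_const _) ?_
    · have := (hX z hz).aemeasurable
      exact AEMeasurable.aestronglyMeasurable (by fun_prop)
    · exact ae_of_all _ fun ω => (Complex.norm_exp_ofReal_mul_I _).le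
    · filter_upwards [hcont] with ω hω
      fun_prop
  have h2 : ContinuousOn (fun z => Real.exp (-(variance (X z) P / 2))) S :=
    h1.norm.congr fun z hz => (norm_integral_cexp_eq_of_hasGaussianLaw (hX z hz)).symm
  refine ((h2.log fun z _ => (Real.exp_pos _).ne').const_smul (-2 : ℝ)).congr fun z _ => ?_
  simp only [Pi.smul_apply, Real.log_exp, smul_eq_mul]
  ring

/-- The mean of a process with Gaussian marginals and almost surely continuous paths is bounded
on compact sets. -/
theorem exists_forall_abs_integral_le_of_hasGaussianLaw [TopologicalSpace.PseudoMetrizableSpace T]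
    [IsProbabilityMeasure P] {S : Set T} (hS : IsCompact S) {X : T → Ω → ℝ}
    (hX : ∀ z ∈ S, HasGaussianLaw (X z) P)
    (hcont : ∀ᵐ ω ∂P, ContinuousOn (fun z => X z ω) S) :
    ∃ B : ℝ, ∀ z ∈ S, |∫ ω, X z ω ∂P| ≤ B := by
  obtain ⟨V, hV⟩ := hS.exists_bound_of_continuousOn
    (continuousOn_variance_of_hasGaussianLaw hX hcont)
  obtain ⟨M, -, A, hAm, hA, hAM⟩ := exists_measurableSet_forall_norm_le hS
    (fun z hz => (hX z hz).aemeasurable) hcont (p := ENNReal.ofReal (1 / 2)) (by simp)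
  obtain ⟨c, hc⟩ : ∃ c : ℝ, c = 1 + 4 * |V| := ⟨_, rfl⟩
  have hc1 : 1 ≤ c := by rw [hc]; linarith [abs_nonneg V]
  refine ⟨M + c, fun z hz => ?_⟩
  have hcheb := meas_ge_le_variance_div_sq (hX z hz).memLp_two (zero_lt_one.trans_le hc1)
  have hlt : ENNReal.ofReal (variance (X z) P / c ^ 2) < ENNReal.ofReal (1 / 2) := by
    rw [ENNReal.ofReal_lt_ofReal_iff (by norm_num), div_lt_iff₀ (by positivity)]
    have := ((le_abs_self _).trans (hV z hz)).trans (le_abs_self V)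
    nlinarith [abs_nonneg V]
  obtain ⟨ω, hωA, hω⟩ : ∃ ω ∈ A, ¬ c ≤ |X z ω - ∫ ω, X z ω ∂P| := by
    by_contra! h
    exact absurd (hA.trans ((measure_mono h).trans hcheb)) hlt.not_ge
  have h1 := hAM ω hωA z hz
  rw [Real.norm_eq_abs] at h1
  rw [not_le] at hω
  have h2 := abs_sub_abs_le_abs_sub (∫ ω, X z ω ∂P) (X z ω)
  rw [abs_sub_comm] at h2
  linarith

end GaussianMoments

section PosteriorProcess

variable {T Ω : Type*} [MeasurableSpace Ω] {P : Measure Ω}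

theorem IsGP.hasGaussianLaw {f : T → Ω → ℝ} {m : T → ℝ} {c : T → T → ℝ} (hf : IsGP f m c P)
    (z : T) : HasGaussianLaw (f z) P :=
  hf.gaussian.hasGaussianLaw_eval z

theorem IsGP.variance_eq {f : T → Ω → ℝ} {m : T → ℝ} {c : T → T → ℝ} (hf : IsGP f m c P)
    (z : T) : variance (f z) P = c z z := by
  rw [← hf.cov_eq, covariance_self (hf.hasGaussianLaw z).aemeasurable]

/-- The variances of the components of a vector-valued Gaussian process with almost surely
continuous paths have a common positive lower bound on a compact set on which none vanishes. -/
theorem IsVectorGP.exists_forall_le_cov [TopologicalSpace T] [FirstCountableTopology T]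
    [IsProbabilityMeasure P] {n : ℕ} {f : T → Ω → EuclideanSpace ℝ (Fin n)} {m : Fin n → T → ℝ}
    {c : Fin n → T → T → ℝ} (hf : IsVectorGP f m c P) {S : Set T} (hS : IsCompact S)
    (hcont : ∀ᵐ ω ∂P, ContinuousOn (fun z => f z ω) S) (hpos : ∀ z ∈ S, ∀ i, 0 < c i z z) :
    ∃ r : ℝ, 0 < r ∧ ∀ z ∈ S, ∀ i, r ≤ c i z z := by
  have hi : ∀ i, ∃ r : ℝ, 0 < r ∧ ∀ z ∈ S, r ≤ c i z z := by
    intro i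
    have hc := continuousOn_variance_of_hasGaussianLaw (S := S)
      (fun z _ => (hf.isGP i).hasGaussianLaw z)
      (hcont.mono fun ω hω => (EuclideanSpace.proj (𝕜 := ℝ) i).continuous.comp_continuousOn hω)
    obtain ⟨r, hr, h⟩ := hS.exists_forall_le' hc (a := 0)
      fun z hz => ((hf.isGP i).variance_eq z).symm ▸ hpos z hz i
    exact ⟨r, hr, fun z hz => (h z hz).trans_eq ((hf.isGP i).variance_eq z)⟩
  choose r hr h using hi
  obtain ⟨r₀, hr₀, h₀⟩ : ∃ r₀ : ℝ, 0 < r₀ ∧ ∀ i, r₀ ≤ r i := by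
    obtain hn | hn := isEmpty_or_nonempty (Fin n)
    · exact ⟨1, one_pos, fun i => hn.elim i⟩
    · obtain ⟨i, hi⟩ := Finite.exists_min r
      exact ⟨r i, hr i, hi⟩
  exact ⟨r₀, hr₀, fun z hz i => (h₀ i).trans (h i z hz)⟩

/-- The mean vector of a vector-valued Gaussian process with almost surely continuous paths is
bounded on compact sets. -/
theorem IsVectorGP.exists_forall_norm_mean_le [TopologicalSpace T]
    [TopologicalSpace.PseudoMetrizableSpace T]
    [IsProbabilityMeasure P] {n : ℕ} {f : T → Ω → EuclideanSpace ℝ (Fin n)} {m : Fin n → T → ℝ}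
    {c : Fin n → T → T → ℝ} (hf : IsVectorGP f m c P) {S : Set T} (hS : IsCompact S)
    (hcont : ∀ᵐ ω ∂P, ContinuousOn (fun z => f z ω) S) :
    ∃ B : ℝ, 0 ≤ B ∧ ∀ z ∈ S, ‖(WithLp.toLp 2 fun i => m i z : EuclideanSpace ℝ (Fin n))‖ ≤ B := by
  have hi : ∀ i, ∃ B : ℝ, ∀ z ∈ S, |m i z| ≤ B := by
    intro i
    obtain ⟨B, hB⟩ := exists_forall_abs_integral_le_of_hasGaussianLaw hS
      (fun z _ => (hf.isGP i).hasGaussianLaw z)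
      (hcont.mono fun ω hω => (EuclideanSpace.proj (𝕜 := ℝ) i).continuous.comp_continuousOn hω)
    exact ⟨B, fun z hz => (hf.isGP i).mean_eq z ▸ hB z hz⟩
  choose B hB using hi
  refine ⟨√(∑ i, B i ^ 2), Real.sqrt_nonneg _, fun z hz => ?_⟩
  rw [EuclideanSpace.norm_eq]
  exact Real.sqrt_le_sqrt (Finset.sum_le_sum fun i _ =>
    pow_le_pow_left₀ (norm_nonneg _) (hB i z hz) 2)

theorem IsVectorGP.aemeasurable {n : ℕ} {f : T → Ω → EuclideanSpace ℝ (Fin n)}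
    {m : Fin n → T → ℝ} {c : Fin n → T → T → ℝ} (hf : IsVectorGP f m c P) (z : T) :
    AEMeasurable (f z) P :=
  (PiLp.continuous_toLp 2 _).measurable.comp_aemeasurable
    (aemeasurable_pi_lambda _ fun i => ((hf.isGP i).hasGaussianLaw z).aemeasurable)

end PosteriorProcess

end GPProjection

open GPProjection in
theorem theorem2 {d n l N : ℕ}
    {Ω : Type*} [MeasurableSpace Ω] (P : Measure Ω) [IsProbabilityMeasure P]
    -- compact set of states under consideration
    (S : Set (EuclideanSpace ℝ (Fin d))) (hS : IsCompact S)
    -- prior means, kernels, noise variances and training data of the components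
    (m : Fin n → EuclideanSpace ℝ (Fin d) → ℝ)
    (k : Fin n → EuclideanSpace ℝ (Fin d) → EuclideanSpace ℝ (Fin d) → ℝ)
    (s : Fin n → ℝ≥0)
    (Z : Fin N → EuclideanSpace ℝ (Fin d)) (y : Fin n → Fin N → ℝ)
    (hK : ∀ i, IsUnit (gramMatrix (k i) (s i) Z))
    -- sample of the posterior process
    (vu : EuclideanSpace ℝ (Fin d) → Ω → EuclideanSpace ℝ (Fin n))
    (hvu : IsVectorGP vu (fun i => posteriorMean (m i) (k i) (s i) Z (y i))
      (fun i => posteriorCov (k i) (s i) Z) P)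
    (hcont : ∀ᵐ ω ∂P, ContinuousOn (fun z => vu z ω) S)
    (hpos : ∀ z ∈ S, ∀ i, 0 < posteriorVar (k i) (s i) Z z)
    -- constraint and least-squares projection
    (g : EuclideanSpace ℝ (Fin d) → EuclideanSpace ℝ (Fin n) → EuclideanSpace ℝ (Fin l))
    (v : EuclideanSpace ℝ (Fin d) → EuclideanSpace ℝ (Fin n) → EuclideanSpace ℝ (Fin n))
    (hv : ∀ z ∈ S, ∀ u, IsLeastSquaresProjection (g z) u (v z u))
    (L : ℝ≥0) (hL : ∀ z ∈ S, LipschitzWith L (v z)) :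
    ∀ δ ∈ Set.Ioo (0 : ℝ) 1, ∃ γ : ℝ, 0 < γ ∧
      ∃ E : Set Ω, MeasurableSet E ∧ ENNReal.ofReal (1 - δ) ≤ P E ∧
        ∀ ω ∈ E, ∀ z ∈ S, ∀ i,
          ‖v z (vu z ω) -
              v z (WithLp.toLp 2 fun j => posteriorMean (m j) (k j) (s j) Z (y j) z)‖ <
            Real.sqrt γ * posteriorStd (k i) (s i) Z z := by
  rintro δ ⟨hδ0, -⟩
  obtain ⟨M, hM0, A, hAm, hA, hAM⟩ := exists_measurableSet_forall_norm_le hS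
    (fun z _ => hvu.aemeasurable z) hcont (p := ENNReal.ofReal (1 - δ))
    (ENNReal.ofReal_lt_one.2 (by linarith))
  obtain ⟨B, hB0, hB⟩ := hvu.exists_forall_norm_mean_le hS hcont
  obtain ⟨r, hr, hrS⟩ := hvu.exists_forall_le_cov hS hcont hpos
  have hR : 0 ≤ L * (M + B) := by positivity
  refine ⟨(L * (M + B) + 1) ^ 2 / r, by positivity, A, hAm, hA, fun ω hω z hz i => ?_⟩
  calc ‖v z (vu z ω) - v z (WithLp.toLp 2 fun j => posteriorMean (m j) (k j) (s j) Z (y j) z)‖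
      ≤ L * ‖vu z ω - WithLp.toLp 2 fun j => posteriorMean (m j) (k j) (s j) Z (y j) z‖ :=
        (hL z hz).norm_sub_le _ _
    _ ≤ L * (M + B) := by
        gcongr
        exact (norm_sub_le _ _).trans (add_le_add (hAM ω hω z hz) (hB z hz))
    _ < L * (M + B) + 1 := lt_add_one _
    _ = √((L * (M + B) + 1) ^ 2 / r) * √r := by
        rw [← Real.sqrt_mul (by positivity), div_mul_cancel₀ _ hr.ne',
          Real.sqrt_sq (by positivity)]
    _ ≤ √((L * (M + B) + 1) ^ 2 / r) * posteriorStd (k i) (s i) Z z := by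
        gcongr
        exact Real.sqrt_le_sqrt (hrS z hz i)
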